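/- **Setting.** Let $Q(v_0,\dots,v_{k-1})$, $k\ge 1$, be a full conjunctive query with atoms $R^1,\dots,R^m$ in which every atom has its own relation symbol, the argument list of every atom is a nonempty subsequence of the variable ordering $[v_0,\dots,v_{k-1}]$, and every variable occurs in some atom. An instance $\mathcal A$ assigns to every relation symbol a finite relation over $\mathbb N$ of the right arity; $Q^{\mathcal A}\subseteq\mathbb N^k$ is the set of assignments satisfying all atoms, and $N_{\max}(\mathcal A)$ is the cardinality of the largest relation of $\mathcal A$. A *family of problem instances* is a monotone map $n\mapsto \mathbf K_n$ from a preordered set of parameters (e.g. $\mathbb N$, or $\mathbb N^r$ with the componentwise order) to sets of instances. It is *defined by cardinality constraints on projections* if there is a set of constraints, each consisting of an atom $R^j$, a set $S$ of its argument positions, and a real-valued function $b$ of the parameter, such that $\mathcal A\in\mathbf K_n$ if and only if $|\pi_S(R^{j,\mathcal A})|\le b(n)$ for all these constraints. Put $$q(n)=\max_{\mathcal A\in\mathbf K_n}|Q^{\mathcal A}|,\qquad M(n)=\max_{\mathcal A\in\mathbf K_n}N_{\max}(\mathcal A).$$ *Leapfrog triejoin* computes $Q^{\mathcal A}$ by a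 backtracking search that binds $v_0,v_1,\dots$ in turn. Each relation is presented by a trie iterator with operations key, atEnd, next, seek, open, up. For each variable, a leapfrog join of the iterators of the atoms containing it enumerates the common keys in increasing order, by repeatedly moving the iterator with the smallest key to the least key that is at least the largest current key of the iterators. The operations key and atEnd, the output of a tuple and all bookkeeping steps take time at most $K$; the operations next, seek, open and up on a relation with $N$ tuples take time at most $K(1+\log_2 N)$ (with $\log_2 0$ read as $0$). **Theorem.** Leapfrog triejoin is worst-case optimal, up to a log factor, for families of problem instances defined by cardinality constraints on projections of the input relations. That is: 1. On every instance $\mathcal A$, leapfrog triejoin terminates and outputs every tuple of $Q^{\mathcal A}$ exactly once, and nothing else. 2. There is a constant $C$, depending only on the query and on $K$, such that for every family $(\mathbf K_n)$ defined by cardinality constraints on projections, every parameter $n$ for which $q(n)$ exists and $q(n)\ge 1$, and every $\mathcal A\in\mathbf K_n$, the running time of leapfrog triejoin on $\mathcal A$ is at most $C\,q(n)\,(1+\log_2 N_{\max}(\mathcal A))$; in particular, if $M(n)$ exists, it is at most $C\,q(n)\,(1+\log_2 M(n))$. 3. For every such family and every $n$ for which $q(n)$ exists, any algorithm that outputs exactly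 the tuples of $Q^{\mathcal A}$ for every $\mathcal A\in\mathbf K_n$, and outputs at most one tuple per step, makes at least $q(n)$ steps on some $\mathcal A\in\mathbf K_n$. -/

import Mathlib

/-! ## Queries, instances, families of instances -/

/-- A full conjunctive query `Q(v₀, …, v_{k-1})` in the form used by leapfrog triejoin.
The variables, in the chosen variable ordering, are the elements of `Fin numVars`. Every atom has
its own relation symbol, and its argument list is a nonempty subsequence of the variable ordering
(so no variable is repeated in it and there are no constants). Every variable occurs in an atom. -/
structure JoinQuery where
  numVars : ℕ
  numVars_pos : 0 < numVars
  numAtoms : ℕ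
  arity : Fin numAtoms → ℕ
  arity_pos : ∀ j, 0 < arity j
  args : ∀ j, Fin (arity j) ↪o Fin numVars
  covers : ∀ v, ∃ j, ∃ e, args j e = v

namespace JoinQuery

/-- A problem instance: a finite relation over `ℕ` for every relation symbol of the query. -/
abbrev Instance (Q : JoinQuery) : Type :=
  ∀ j : Fin Q.numAtoms, Finset (Fin (Q.arity j) → ℕ)

/-- An assignment of values to the variables of the query. -/
abbrev Assignment (Q : JoinQuery) : Type := Fin Q.numVars → ℕ

variable {Q : JoinQuery}

/-- The query result: the assignments that satisfy all atoms. -/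
def answers (A : Q.Instance) : Set Q.Assignment :=
  {x | ∀ j, (fun e => x (Q.args j e)) ∈ A j}

/-- The projection of the relation of atom `j` to the argument positions in `cols`. -/
def proj (A : Q.Instance) (j : Fin Q.numAtoms) (cols : Finset (Fin (Q.arity j))) :
    Finset ({e // e ∈ cols} → ℕ) :=
  (A j).image fun t e => t e.1

/-- The cardinality of the largest relation of an instance. -/
def maxCard (A : Q.Instance) : ℕ :=
  Finset.univ.sup fun j => (A j).card

/-- A family of problem instances, indexed by a parameter from a preordered set `P`
(such as `ℕ`, or tuples of natural numbers with the componentwise order). -/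
structure ProblemFamily (Q : JoinQuery) (P : Type*) [Preorder P] where
  inst : P → Set Q.Instance
  mono : Monotone inst

/-- An upper bound, depending on the parameter, on the size of a projection of a relation. -/
structure ProjConstraint (Q : JoinQuery) (P : Type*) where
  atom : Fin Q.numAtoms
  cols : Finset (Fin (Q.arity atom))
  bound : P → ℝ

/-- The family consists of exactly the instances which satisfy the given constraints. -/
def ProblemFamily.IsDefinedBy {P : Type*} [Preorder P] (F : ProblemFamily Q P)
    (cons : Set (ProjConstraint Q P)) : Prop :=
  ∀ n A, A ∈ F.inst n ↔ ∀ c ∈ cons, ((proj A c.atom c.cols).card : ℝ) ≤ c.bound n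

/-! ## Trie iterators -/

/-- The keys of the children of the trie node with the given path from the root,
in increasing order. (Only used for paths shorter than the arity `a`.) -/
def trieChildren {a : ℕ} (R : Finset (Fin a → ℕ)) (path : List ℕ) : List ℕ :=
  ((R.filter fun t => (List.ofFn t).take path.length = path).image
    fun t => (List.ofFn t).getD path.length 0).sort (· ≤ ·)

/-- The state of a trie iterator: for each trie level that has been opened, deepest level first,
the sibling keys from the current position on. The first entry of each list is the key at which
the iterator is positioned on that level; an empty list means that it is at the end there.
The state `[]` is the root. -/
abbrev TrieIter : Type := List (List ℕ)

namespace TrieIter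

def key (it : TrieIter) : ℕ := (it.headD []).headD 0

def atEnd (it : TrieIter) : Bool := (it.headD []).isEmpty

def next : TrieIter → TrieIter
  | [] => []
  | l :: ls => l.tail :: ls

/-- Move to the least key `≥ x` on the current level, or to the end if there is none. -/
def seek (x : ℕ) : TrieIter → TrieIter
  | [] => []
  | l :: ls => l.dropWhile (fun y => decide (y < x)) :: ls

/-- Proceed to the first key on the next level. -/
def descend {a : ℕ} (R : Finset (Fin a → ℕ)) (it : TrieIter) : TrieIter :=
  trieChildren R (it.map fun l => l.headD 0).reverse :: it

/-- Return to the parent key. -/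
def up (it : TrieIter) : TrieIter := it.tail

end TrieIter

/-- The operations of the trie iterator interface (`descend` is the operation `open()`). -/
inductive IterOp where
  | key
  | atEnd
  | next
  | seek (x : ℕ)
  | descend
  | up

/-- The elementary events of an execution: an operation of the trie iterator of an atom, a
bookkeeping step of the RAM, or the output of a result tuple. -/
inductive Event (Q : JoinQuery) where
  | iter (j : Fin Q.numAtoms) (op : IterOp)
  | ram
  | emit (x : Q.Assignment)

/-! ## Leapfrog triejoin -/

/-- The leapfrog join of one variable: the array of (pointers to) the trie iterators of the atoms
which contain the variable, read cyclically from the position `p` on, so that the first entry is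
`Iter[p]` and the last one is `Iter[p - 1]`; and the last key found. -/
structure Frame (Q : JoinQuery) where
  queue : List (Fin Q.numAtoms)
  key : ℕ

/-- The program point. `enter`: call triejoin-open() for the next variable. `search x'`: the head
of the loop of leapfrog-search(), where `x'` is the largest key of any iterator. `result`: the
current leapfrog join is positioned at a key. `advance`: call leapfrog-next(). `leave`: the current
leapfrog join is at its end, call triejoin-up(). -/
inductive Phase where
  | enter
  | search (x' : ℕ)
  | result
  | advance
  | leave
  | done

/-- A state of the execution. `frames` are the leapfrog joins of the variables that have been
opened, deepest first; `trace` records the events so far. -/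
structure Config (Q : JoinQuery) where
  iters : Fin Q.numAtoms → TrieIter
  frames : List (Frame Q)
  phase : Phase
  trace : List (Event Q)

/-- The atoms which contain the variable number `d`. -/
def atomsAt (Q : JoinQuery) (d : ℕ) : List (Fin Q.numAtoms) :=
  (List.finRange Q.numAtoms).filter fun j => decide (∃ e, (Q.args j e : ℕ) = d)

/-- The assignment read off from the keys of the leapfrog joins. -/
def currentAssignment (frames : List (Frame Q)) : Q.Assignment :=
  fun v => (frames.map Frame.key).reverse.getD v 0

/-- The initial state: all trie iterators are at the root, no variable has been opened. -/
def initConfig (Q : JoinQuery) : Config Q where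
  iters := fun _ => []
  frames := []
  phase := .enter
  trace := []

/-- triejoin-open(), including leapfrog-init(), which tests whether an iterator is at the end, and
otherwise sorts the `k` iterators by their keys (with at most `k ^ 2` comparisons) and starts
leapfrog-search() by reading the largest key. -/
def stepEnter (A : Q.Instance) (c : Config Q) : Config Q :=
  let js := atomsAt Q c.frames.length
  let iters : Fin Q.numAtoms → TrieIter :=
    fun j => if j ∈ js then (c.iters j).descend (A j) else c.iters j
  let ev := js.map (fun j => Event.iter j .descend) ++ js.map (fun j => Event.iter j .atEnd)
  if js.any (fun j => (iters j).atEnd) then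
    { iters := iters
      frames := ⟨js, 0⟩ :: c.frames
      phase := .leave
      trace := c.trace ++ ev }
  else
    let queue := js.insertionSort (fun i j => (iters i).key ≤ (iters j).key)
    { iters := iters
      frames := ⟨queue, 0⟩ :: c.frames
      phase := .search ((queue.getLast?.map fun j => (iters j).key).getD 0)
      trace := c.trace ++ ev ++ js.map (fun j => Event.iter j .key)
        ++ List.replicate (js.length ^ 2) .ram
        ++ queue.getLast?.toList.map (fun j => Event.iter j .key) }

/-- One iteration of the loop of leapfrog-search(). -/
def stepSearch (x' : ℕ) (c : Config Q) : Config Q :=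
  match c.frames with
  | ⟨j :: rest, key⟩ :: fs =>
    let x := (c.iters j).key
    if x = x' then
      { c with
        frames := ⟨j :: rest, x⟩ :: fs
        phase := .result
        trace := c.trace ++ [.iter j .key, .ram] }
    else
      let it := (c.iters j).seek x'
      let ev := [.iter j .key, .ram, .iter j (.seek x'), .iter j .atEnd]
      if it.atEnd then
        { iters := Function.update c.iters j it
          frames := c.frames
          phase := .leave
          trace := c.trace ++ ev }
      else
        { iters := Function.update c.iters j it
          frames := ⟨rest ++ [j], key⟩ :: fs
          phase := .search it.key
          trace := c.trace ++ ev ++ [.iter j .key, .ram] }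
  | _ => c

/-- A key has been found: output the assignment if all variables are bound, and go on with the next
key; otherwise turn to the next variable. -/
def stepResult (c : Config Q) : Config Q :=
  if c.frames.length = Q.numVars then
    { c with
      phase := .advance
      trace := c.trace ++ [.ram, .emit (currentAssignment c.frames)] }
  else
    { c with
      phase := .enter
      trace := c.trace ++ [.ram] }

/-- leapfrog-next(), up to the loop of leapfrog-search(). -/
def stepAdvance (c : Config Q) : Config Q :=
  match c.frames with
  | ⟨j :: rest, key⟩ :: fs =>
    let it := (c.iters j).next
    let ev := [.iter j .next, .iter j .atEnd]
    if it.atEnd then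
      { iters := Function.update c.iters j it
        frames := c.frames
        phase := .leave
        trace := c.trace ++ ev }
    else
      { iters := Function.update c.iters j it
        frames := ⟨rest ++ [j], key⟩ :: fs
        phase := .search it.key
        trace := c.trace ++ ev ++ [.ram, .iter j .key] }
  | _ => c

/-- triejoin-up(), after which the traversal goes on with the next key of the previous variable,
if there is one. -/
def stepLeave (c : Config Q) : Config Q :=
  match c.frames with
  | f :: fs =>
    { iters := fun j => if j ∈ f.queue then (c.iters j).up else c.iters j
      frames := fs
      phase := if fs.isEmpty then .done else .advance
      trace := c.trace ++ f.queue.map (fun j => Event.iter j .up) ++ [.ram] }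
  | [] => c

/-- One step of the complete traversal of the trie presented by leapfrog triejoin. -/
def step (A : Q.Instance) (c : Config Q) : Config Q :=
  match c.phase with
  | .enter => stepEnter A c
  | .search x' => stepSearch x' c
  | .result => stepResult c
  | .advance => stepAdvance c
  | .leave => stepLeave c
  | .done => c

/-- Leapfrog triejoin terminates on the instance `A`, and `tr` is the list of the events of
its execution. -/
def LeapfrogTriejoin (A : Q.Instance) (tr : List (Event Q)) : Prop :=
  ∃ t : ℕ, ((step A)^[t] (initConfig Q)).phase = .done ∧ ((step A)^[t] (initConfig Q)).trace = tr

/-- The tuples output in an execution, in the order of their output. -/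
def output (tr : List (Event Q)) : List Q.Assignment :=
  tr.filterMap fun
    | .emit x => some x
    | _ => none

/-! ## Running time -/

/-- The times taken by the events: `T A h e` is the time of the event `e` on the instance `A` after
the events `h` (it may depend on the past, as an implementation of iterators has an
internal state). -/
abbrev CostModel (Q : JoinQuery) : Type :=
  Q.Instance → List (Event Q) → Event Q → ℕ

/-- The requirements on the iterators, with constant `K`: `key()` and `atEnd()` take time `O(1)`,
and `next()`, `seek()`, `open()`, `up()` take time `O(log N)`, where `N` is the cardinality of the
relation (read as `O(1 + log N)`, as `N = 1` is possible). Other steps take time `O(1)`. -/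
def CostModel.Meets (T : CostModel Q) (K : ℕ) : Prop :=
  ∀ A h,
    T A h .ram ≤ K ∧ (∀ x, T A h (.emit x) ≤ K) ∧
    ∀ j, T A h (.iter j .key) ≤ K ∧ T A h (.iter j .atEnd) ≤ K ∧
      ∀ op, (T A h (.iter j op) : ℝ) ≤ K * (1 + Real.logb 2 (A j).card)

/-- The time of an execution with the events `tr`. -/
def CostModel.time (T : CostModel Q) (A : Q.Instance) (tr : List (Event Q)) : ℕ :=
  ∑ i : Fin tr.length, T A (tr.take i) (tr.get i)

/-- An arbitrary deterministic join algorithm, of which only this is recorded: on every instance it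
makes a finite sequence of steps, and each step outputs at most one tuple. -/
abbrev Algorithm (Q : JoinQuery) : Type := Q.Instance → List (Option Q.Assignment)

/-- The algorithm outputs exactly the tuples of the query result on the instances in `S`. -/
def Algorithm.Computes (B : Algorithm Q) (S : Set Q.Instance) : Prop :=
  ∀ A ∈ S, ∀ x, some x ∈ B A ↔ x ∈ answers A

end JoinQuery

/-!
Leapfrog triejoin walks through the tree of partial answers, i.e. of those bindings of the first
variables which are consistent with each atom separately. At a node, the leapfrog join of the next
variable makes at most as many rounds as the smallest of the participating iterators has keys: in
each full round every iterator moves forward. So the total number of events is, up to a factor that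
depends on the query, at most the sum over all levels `d` and all nodes of level `d` of this
smallest number.

For a fixed level `d` this sum is bounded by the number of answers of another instance of the same
family: in every relation, the value of the variable `d` is replaced by its rank among its siblings
in the trie, and all later values are replaced by `0`. If every atom offers more than `r` keys at a
node, then the node extended by the key `r` is an answer of the renumbered instance. Renumbering
does not increase the size of a projection of a relation beyond `1`, hence it does not leave the
family if some instance of the family has an answer.
-/

namespace JoinQuery

variable {Q : JoinQuery}

section Lists

variable {α : Type*}

lemma headD_le_of_mem [Preorder α] {l : List α} (hl : l.Pairwise (· < ·)) {y : α} (hy : y ∈ l)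
    (a : α) : l.headD a ≤ y := by
  cases l with
  | nil => simp at hy
  | cons b l =>
    rcases List.mem_cons.1 hy with rfl | hy
    · exact le_rfl
    · exact (List.rel_of_pairwise_cons hl hy).le

lemma headD_mem {l : List α} (hl : l ≠ []) (a : α) : l.headD a ∈ l := by
  cases l with
  | nil => exact absurd rfl hl
  | cons b l => exact List.mem_cons_self

lemma length_tail_lt {l : List α} (hl : l ≠ []) : l.tail.length < l.length := by
  simpa using List.length_pos_iff.2 hl

variable [LinearOrder α]

lemma length_dropWhile_lt {l : List α} {x a : α} (hl : l ≠ []) (hx : l.headD a < x) :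
    (l.dropWhile fun y => decide (y < x)).length < l.length := by
  cases l with
  | nil => exact absurd rfl hl
  | cons b l =>
    have hbx : b < x := hx
    simp only [List.dropWhile_cons, hbx, decide_true, if_true, List.length_cons]
    exact Nat.lt_succ_of_le (List.dropWhile_suffix _).length_le

lemma le_headD_dropWhile {l : List α} {x : α} (hl : (l.dropWhile fun y => decide (y < x)) ≠ [])
    (a : α) : x ≤ (l.dropWhile fun y => decide (y < x)).headD a := by
  have hhead := List.head_dropWhile_not (fun y => decide (y < x)) hl
  rw [List.headD_eq_head?_getD, List.head?_eq_some_head hl]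
  simpa using hhead

lemma mem_dropWhile_of_le {l : List α} {x y : α} (hy : y ∈ l) (hxy : x ≤ y) :
    y ∈ l.dropWhile fun z => decide (z < x) := by
  have hsplit := List.takeWhile_append_dropWhile (p := fun z => decide (z < x)) (l := l)
  rw [← hsplit, List.mem_append] at hy
  refine hy.resolve_left fun hy => ?_
  exact hxy.not_gt (by simpa using List.mem_takeWhile_imp hy)

end Lists

/-! ### The leapfrog join of one variable -/

section LeapfrogJoin

variable {ι : Type*}

/-- The invariant of leapfrog-search() for iterators with remaining keys `l j`: they are in `queue`
in the order of their current keys, of which `x'` is the largest one. -/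
structure JoinInv (l : ι → List ℕ) (queue : List ι) (x' : ℕ) : Prop where
  nodup : queue.Nodup
  sorted : ∀ j ∈ queue, (l j).Pairwise (· < ·)
  ne_nil : ∀ j ∈ queue, l j ≠ []
  mono : queue.Pairwise fun i j => (l i).headD 0 ≤ (l j).headD 0
  le : ∀ j ∈ queue, (l j).headD 0 ≤ x'
  attained : ∃ j ∈ queue, (l j).headD 0 = x'

/-- `ys` lists in increasing order the keys that all iterators in `queue`, with remaining
keys `l j`, have in common. It is what a leapfrog join still has to enumerate. -/
structure IsCommonKeys (l : ι → List ℕ) (queue : List ι) (ys : List ℕ) : Prop where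
  sorted : ys.Pairwise (· < ·)
  mem_iff : ∀ y, y ∈ ys ↔ ∀ j ∈ queue, y ∈ l j

section Hit

variable {l : ι → List ℕ} {queue : List ι} {ys : List ℕ}

lemma JoinInv.headD_eq {j : ι} {x' : ℕ} (h : JoinInv l (j :: queue) x')
    (hj : (l j).headD 0 = x') : ∀ i ∈ j :: queue, (l i).headD 0 = x' := by
  intro i hi
  refine le_antisymm (h.le i hi) ?_
  rcases List.mem_cons.1 hi with rfl | hi
  · exact hj.ge
  · exact hj.ge.trans (List.rel_of_pairwise_cons h.mono hi)

lemma JoinInv.le_headD_tail {j : ι} {x' : ℕ} (h : JoinInv l (j :: queue) x')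
    (hj : (l j).headD 0 = x') (htail : (l j).tail ≠ []) : x' ≤ (l j).tail.headD 0 :=
  hj ▸ headD_le_of_mem (h.sorted j (by simp)) (List.mem_of_mem_tail (headD_mem htail 0)) 0

lemma IsCommonKeys.of_perm {queue' : List ι} (h : IsCommonKeys l queue ys)
    (hq : queue.Perm queue') : IsCommonKeys l queue' ys :=
  ⟨h.sorted, fun y => by simp only [h.mem_iff, hq.mem_iff]⟩

lemma IsCommonKeys.eq_nil (h : IsCommonKeys l queue ys) {j : ι} (hj : j ∈ queue) (hl : l j = []) :
    ys = [] :=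
  List.eq_nil_iff_forall_not_mem.2 fun y hy => by simpa [hl] using (h.mem_iff y).1 hy j hj

lemma IsCommonKeys.eq_cons {j : ι} {x' : ℕ} (h : IsCommonKeys l (j :: queue) ys)
    (hinv : JoinInv l (j :: queue) x') (hj : (l j).headD 0 = x') : ∃ ys', ys = x' :: ys' := by
  have hmem : x' ∈ ys := (h.mem_iff x').2 fun i hi => by
    rw [← hinv.headD_eq hj i hi]
    exact headD_mem (hinv.ne_nil i hi) 0
  have hle : ∀ y ∈ ys, x' ≤ y := fun y hy =>
    hj ▸ headD_le_of_mem (hinv.sorted j (by simp)) ((h.mem_iff y).1 hy j (by simp)) 0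
  obtain ⟨z, ys', rfl⟩ := List.exists_cons_of_ne_nil (List.ne_nil_of_mem hmem)
  obtain rfl : z = x' := le_antisymm (headD_le_of_mem h.sorted hmem 0) (hle z (by simp))
  exact ⟨ys', rfl⟩

end Hit

lemma joinInv_insertionSort {l : ι → List ℕ} {js : List ι} (hnodup : js.Nodup)
    (hsorted : ∀ j ∈ js, (l j).Pairwise (· < ·)) (hne : ∀ j ∈ js, l j ≠ []) {key : ι → ℕ}
    (hkey : ∀ j ∈ js, key j = (l j).headD 0) {last : ι}
    (hlast : (js.insertionSort fun i j => key i ≤ key j).getLast? = some last) :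
    JoinInv l (js.insertionSort fun i j => key i ≤ key j) (key last) := by
  set queue := js.insertionSort fun i j => key i ≤ key j
  have hperm : queue.Perm js := List.perm_insertionSort _ _
  have : Std.Total fun i j => key i ≤ key j := ⟨fun i j => le_total _ _⟩
  have : IsTrans _ fun i j => key i ≤ key j := ⟨fun i j k => le_trans⟩
  have hmono : queue.Pairwise fun i j => key i ≤ key j := List.pairwise_insertionSort _ _
  obtain ⟨init, hinit⟩ := List.getLast?_eq_some_iff.1 hlast
  have hmem : last ∈ queue := by simp [hinit]
  refine ⟨hperm.nodup_iff.2 hnodup, fun j hj => hsorted j (hperm.subset hj),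
    fun j hj => hne j (hperm.subset hj), ?_, fun j hj => ?_,
    ⟨last, hmem, (hkey last (hperm.subset hmem)).symm⟩⟩
  · refine hmono.imp_of_mem fun {i j} hi hj hij => ?_
    rwa [hkey i (hperm.subset hi), hkey j (hperm.subset hj)] at hij
  · rw [← hkey j (hperm.subset hj)]
    rw [hinit] at hmono hj
    rcases List.mem_append.1 hj with hj | hj
    · exact (List.pairwise_append.1 hmono).2.2 j hj last (by simp)
    · rw [List.mem_singleton.1 hj]

variable [DecidableEq ι] {l : ι → List ℕ} {j : ι} {rest : List ι} {x' : ℕ} {ys : List ℕ}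

lemma JoinInv.rotate (h : JoinInv l (j :: rest) x') {s : List ℕ} (hs : s ≠ [])
    (hsub : s.Sublist (l j)) (hle : x' ≤ s.headD 0) :
    JoinInv (Function.update l j s) (rest ++ [j]) (s.headD 0) := by
  have hperm := List.perm_append_singleton j rest
  have hne : ∀ i ∈ rest, i ≠ j := fun i hi e => (List.nodup_cons.1 h.nodup).1 (e ▸ hi)
  have hcases : ∀ i ∈ rest ++ [j], i ∈ rest ∧ i ≠ j ∨ i = j := fun i hi => by
    simpa [hne i] using (List.mem_append.1 hi).imp_left fun hi => And.intro hi (hne i hi)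
  refine ⟨hperm.nodup_iff.2 h.nodup, fun i hi => ?_, fun i hi => ?_, ?_, fun i hi => ?_,
    ⟨j, by simp, by simp⟩⟩
  · obtain ⟨-, e⟩ | rfl := hcases i hi
    · simpa [e] using h.sorted i (hperm.subset hi)
    · simpa using (h.sorted i (by simp)).sublist hsub
  · obtain ⟨-, e⟩ | rfl := hcases i hi
    · simpa [e] using h.ne_nil i (hperm.subset hi)
    · simpa using hs
  · refine List.pairwise_append.2 ⟨?_, by simp, ?_⟩
    · refine (List.pairwise_cons.1 h.mono).2.imp_of_mem fun {a b} ha hb hab => ?_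
      simpa [hne a ha, hne b hb] using hab
    · intro i hi b hb
      obtain rfl : b = j := by simpa using hb
      simpa [hne i hi] using (h.le i (by simp [hi])).trans hle
  · obtain ⟨-, e⟩ | rfl := hcases i hi
    · simpa [e] using (h.le i (hperm.subset hi)).trans hle
    · simp

lemma IsCommonKeys.seek (h : IsCommonKeys l (j :: rest) ys) (hinv : JoinInv l (j :: rest) x') :
    IsCommonKeys (Function.update l j ((l j).dropWhile fun y => decide (y < x')))
      (j :: rest) ys := by
  refine ⟨h.sorted, fun y => (h.mem_iff y).trans ⟨fun hy i hi => ?_, fun hy i hi => ?_⟩⟩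
  · obtain rfl | e := eq_or_ne i j
    · obtain ⟨i', hi', rfl⟩ := hinv.attained
      simpa using mem_dropWhile_of_le (hy i hi) (headD_le_of_mem (hinv.sorted i' hi') (hy i' hi') 0)
    · simpa [e] using hy i hi
  · obtain rfl | e := eq_or_ne i j
    · exact (List.dropWhile_sublist _).subset (by simpa using hy i hi)
    · simpa [e] using hy i hi

lemma IsCommonKeys.next (h : IsCommonKeys l (j :: rest) (x' :: ys))
    (hinv : JoinInv l (j :: rest) x') (hj : (l j).headD 0 = x') :
    IsCommonKeys (Function.update l j (l j).tail) (j :: rest) ys := by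
  obtain ⟨z, r, hr⟩ := List.exists_cons_of_ne_nil (hinv.ne_nil j (by simp))
  obtain rfl : z = x' := by simpa [hr] using hj
  have hzr : ∀ y ∈ r, z ≠ y := by
    have := hinv.sorted j (by simp)
    rw [hr] at this
    exact fun y hy => (List.rel_of_pairwise_cons this hy).ne
  have hzys : ∀ y ∈ ys, z ≠ y := fun y hy => (List.rel_of_pairwise_cons h.sorted hy).ne
  refine ⟨(List.pairwise_cons.1 h.sorted).2, fun y => ⟨fun hy i hi => ?_, fun hy => ?_⟩⟩
  · have hyi := (h.mem_iff y).1 (List.mem_cons_of_mem _ hy) i hi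
    obtain rfl | e := eq_or_ne i j
    · simpa [hr, (hzys y hy).symm] using hyi
    · simpa [e] using hyi
  · have hyr : y ∈ r := by simpa [hr] using hy j (by simp)
    have hmem : y ∈ z :: ys := (h.mem_iff y).2 fun i hi => by
      obtain rfl | e := eq_or_ne i j
      · simp [hr, hyr]
      · simpa [e] using hy i hi
    exact (List.mem_cons.1 hmem).resolve_left (hzr y hyr).symm

/-- A measure of the remaining work of a leapfrog join, in terms of the iterator `j₀` alone: every
move of the first iterator in the queue to the end of it brings `j₀` nearer to the front, and every
`queue.length` moves `j₀` itself advances. -/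
def potential (l : ι → List ℕ) (queue : List ι) (j₀ : ι) : ℕ :=
  queue.length * (l j₀).length + queue.idxOf j₀

lemma potential_rotate_lt {j₀ : ι} (hj₀ : j₀ ∈ j :: rest) {s : List ℕ}
    (hs : s.length < (l j).length) :
    potential (Function.update l j s) (rest ++ [j]) j₀ < potential l (j :: rest) j₀ := by
  obtain rfl | hne := eq_or_ne j₀ j
  · have hidx : (rest ++ [j₀]).idxOf j₀ ≤ rest.length := by
      have := List.idxOf_lt_length_iff.2 (show j₀ ∈ rest ++ [j₀] by simp)
      simpa [Nat.lt_succ_iff] using this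
    have hmul := Nat.mul_le_mul_left (rest.length + 1) hs
    simp only [potential, List.length_append, List.length_cons, List.length_nil, zero_add,
      Function.update_self, List.idxOf_cons_self]
    linarith
  · have hmem : j₀ ∈ rest := (List.mem_cons.1 hj₀).resolve_left hne
    simp [potential, hne, List.idxOf_append_of_mem hmem, List.idxOf_cons_ne _ hne.symm]

lemma JoinInv.length_le_potential {queue : List ι} (h : JoinInv l queue x') {j₀ : ι}
    (hj₀ : j₀ ∈ queue) : queue.length ≤ potential l queue j₀ :=
  (Nat.le_mul_of_pos_right _ (List.length_pos_iff.2 (h.ne_nil j₀ hj₀))).trans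
    (Nat.le_add_right _ _)

end LeapfrogJoin

/-! ### Executions -/

lemma output_append (evs evs' : List (Event Q)) :
    output (evs ++ evs') = output evs ++ output evs' := by
  simp [output]

/-- A state of leapfrog triejoin without the record of the past events. -/
structure State (Q : JoinQuery) where
  iters : Fin Q.numAtoms → TrieIter
  frames : List (Frame Q)
  phase : Phase

/-- The configuration with state `s` which is reached by the events `tr`. -/
def State.withTrace (s : State Q) (tr : List (Event Q)) : Config Q :=
  ⟨s.iters, s.frames, s.phase, tr⟩

/-- From the state `s`, leapfrog triejoin reaches `s'` by at most `n` events, which output `out`. -/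
def Runs (A : Q.Instance) (s s' : State Q) (out : List Q.Assignment) (n : ℕ) : Prop :=
  ∃ evs, output evs = out ∧ evs.length ≤ n ∧
    ∀ tr, ∃ t, (step A)^[t] (s.withTrace tr) = s'.withTrace (tr ++ evs)

namespace Runs

variable {A : Q.Instance} {s s' s'' : State Q} {out out' : List Q.Assignment} {n n' : ℕ}

lemma of_step {evs : List (Event Q)}
    (h : ∀ tr, step A (s.withTrace tr) = s'.withTrace (tr ++ evs)) (hout : output evs = out)
    (hlen : evs.length ≤ n) : Runs A s s' out n :=
  ⟨evs, hout, hlen, fun tr => ⟨1, h tr⟩⟩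

lemma trans (h : Runs A s s' out n) (h' : Runs A s' s'' out' n') :
    Runs A s s'' (out ++ out') (n + n') := by
  obtain ⟨evs, rfl, hlen, hreach⟩ := h
  obtain ⟨evs', rfl, hlen', hreach'⟩ := h'
  refine ⟨evs ++ evs', output_append _ _, by simpa using Nat.add_le_add hlen hlen', fun tr => ?_⟩
  obtain ⟨t, ht⟩ := hreach tr
  obtain ⟨t', ht'⟩ := hreach' (tr ++ evs)
  exact ⟨t' + t, by rw [Function.iterate_add_apply, ht, ht', List.append_assoc]⟩

lemma mono (h : Runs A s s' out n) (hn : n ≤ n') : Runs A s s' out n' := by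
  obtain ⟨evs, hout, hlen, hreach⟩ := h
  exact ⟨evs, hout, hlen.trans hn, hreach⟩

end Runs

section OpenIters

variable {ι β : Type*} [DecidableEq ι]

/-- The iterators in `js` have one more level open than in `base`, with remaining keys `l j`. -/
def openIters (js : List ι) (base : ι → TrieIter) (l : ι → List ℕ) : ι → TrieIter :=
  fun j => if j ∈ js then l j :: base j else base j

variable {js : List ι} {base : ι → TrieIter} {l : ι → List ℕ} {j : ι}

lemma openIters_of_mem (hj : j ∈ js) : openIters js base l j = l j :: base j :=
  if_pos hj

lemma update_openIters (hj : j ∈ js) (s : List ℕ) :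
    Function.update (openIters js base l) j (s :: base j) =
      openIters js base (Function.update l j s) := by
  funext i
  obtain rfl | hij := eq_or_ne i j
  · simp [openIters, hj]
  · simp [openIters, hij]

lemma up_openIters {queue : List ι} (hq : queue.Perm js) :
    (fun j => if j ∈ queue then (openIters js base l j).up else openIters js base l j) = base := by
  funext j
  simp only [openIters, hq.mem_iff]
  split_ifs <;> rfl

end OpenIters

/-- The state after triejoin-up() has restored the iterators `base` and the frames `fs`. -/
def afterLeave (base : Fin Q.numAtoms → TrieIter) (fs : List (Frame Q)) : State Q :=
  ⟨base, fs, if fs.isEmpty then .done else .advance⟩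

/-- The state after the first iterator `j` of the queue `j :: rest` has been moved on such that the
keys `s` remain. -/
def afterMove (js : List (Fin Q.numAtoms)) (base : Fin Q.numAtoms → TrieIter) (fs : List (Frame Q))
    (l : Fin Q.numAtoms → List ℕ) (j : Fin Q.numAtoms) (rest : List (Fin Q.numAtoms)) (key : ℕ)
    (s : List ℕ) : State Q :=
  if s = [] then ⟨openIters js base (Function.update l j s), ⟨j :: rest, key⟩ :: fs, .leave⟩
  else ⟨openIters js base (Function.update l j s), ⟨rest ++ [j], key⟩ :: fs, .search (s.headD 0)⟩

section Steps

variable (A : Q.Instance) {js : List (Fin Q.numAtoms)} (base : Fin Q.numAtoms → TrieIter)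
  (fs : List (Frame Q)) (l : Fin Q.numAtoms → List ℕ) {j : Fin Q.numAtoms}
  (rest : List (Fin Q.numAtoms)) (key : ℕ)

lemma runs_search_hit (hj : j ∈ js) {x' : ℕ} (hx : (l j).headD 0 = x') :
    Runs A ⟨openIters js base l, ⟨j :: rest, key⟩ :: fs, .search x'⟩
      ⟨openIters js base l, ⟨j :: rest, x'⟩ :: fs, .result⟩ [] 2 := by
  refine .of_step (evs := [.iter j .key, .ram]) (fun tr => ?_) rfl le_rfl
  simp only [step, stepSearch, State.withTrace, openIters_of_mem hj, TrieIter.key,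
    List.headD_cons, hx, if_true]

lemma runs_search_seek (hj : j ∈ js) {x' : ℕ} (hx : (l j).headD 0 ≠ x') :
    Runs A ⟨openIters js base l, ⟨j :: rest, key⟩ :: fs, .search x'⟩
      (afterMove js base fs l j rest key ((l j).dropWhile fun y => decide (y < x'))) [] 6 := by
  set s := (l j).dropWhile fun y => decide (y < x') with hs
  refine .of_step (evs := [.iter j .key, .ram, .iter j (.seek x'), .iter j .atEnd] ++
    if s = [] then [] else [.iter j .key, .ram]) (fun tr => ?_) ?_ ?_
  · simp only [step, stepSearch, State.withTrace, openIters_of_mem hj, TrieIter.key,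
      List.headD_cons, hx, if_false, TrieIter.seek, TrieIter.atEnd, update_openIters hj, ← hs,
      List.isEmpty_iff, afterMove]
    split_ifs <;> simp
  all_goals split_ifs <;> simp [output]

lemma runs_advance (hj : j ∈ js) :
    Runs A ⟨openIters js base l, ⟨j :: rest, key⟩ :: fs, .advance⟩
      (afterMove js base fs l j rest key (l j).tail) [] 4 := by
  refine .of_step (evs := [.iter j .next, .iter j .atEnd] ++
    if (l j).tail = [] then [] else [.ram, .iter j .key]) (fun tr => ?_) ?_ ?_
  · simp only [step, stepAdvance, State.withTrace, openIters_of_mem hj, TrieIter.key,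
      List.headD_cons, TrieIter.next, TrieIter.atEnd, update_openIters hj, List.isEmpty_iff,
      afterMove]
    split_ifs <;> simp
  all_goals split_ifs <;> simp [output]

lemma runs_leave {queue : List (Fin Q.numAtoms)} (hq : queue.Perm js) :
    Runs A ⟨openIters js base l, ⟨queue, key⟩ :: fs, .leave⟩ (afterLeave base fs) []
      (js.length + 1) := by
  refine .of_step (evs := queue.map (fun j => Event.iter j .up) ++ [.ram]) (fun tr => ?_) ?_ ?_
  · simp only [step, stepLeave, State.withTrace, up_openIters hq, afterLeave, List.append_assoc]
  · simp [output]
  · simp [hq.length_eq]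

end Steps

theorem runs_search {A : Q.Instance} {js : List (Fin Q.numAtoms)}
    {base : Fin Q.numAtoms → TrieIter} {fs : List (Frame Q)} {sub : ℕ → List Q.Assignment}
    {w : ℕ → ℕ}
    (hres : ∀ queue l x, (∀ j ∈ js, (l j).headD 0 = x) →
      Runs A ⟨openIters js base l, ⟨queue, x⟩ :: fs, .result⟩
        ⟨openIters js base l, ⟨queue, x⟩ :: fs, .advance⟩ (sub x) (w x))
    {j₀ : Fin Q.numAtoms} (hj₀ : j₀ ∈ js) (n : ℕ) {queue : List (Fin Q.numAtoms)}
    {l : Fin Q.numAtoms → List ℕ} {x' : ℕ} {ys : List ℕ} (key : ℕ) (hperm : queue.Perm js)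
    (hinv : JoinInv l queue x') (hkeys : IsCommonKeys l queue ys)
    (hn : potential l queue j₀ < n + queue.length) :
    Runs A ⟨openIters js base l, ⟨queue, key⟩ :: fs, .search x'⟩ (afterLeave base fs)
      (ys.flatMap sub) (6 * n + (ys.map w).sum + (js.length + 1)) := by
  induction n generalizing queue l x' ys key with
  | zero => exact absurd hn (by simpa using hinv.length_le_potential (hperm.mem_iff.2 hj₀))
  | succ n ih =>
    obtain ⟨j, rest, rfl⟩ := List.exists_cons_of_ne_nil
      (List.ne_nil_of_mem (hperm.mem_iff.2 hj₀))
    have hj : j ∈ js := hperm.subset (by simp)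
    have hrot := List.perm_append_singleton j rest
    have move : ∀ (key : ℕ) (s ys' : List ℕ), s.Sublist (l j) → s.length < (l j).length →
        (s ≠ [] → x' ≤ s.headD 0) → IsCommonKeys (Function.update l j s) (j :: rest) ys' →
        Runs A (afterMove js base fs l j rest key s) (afterLeave base fs) (ys'.flatMap sub)
          (6 * n + (ys'.map w).sum + (js.length + 1)) := by
      intro key s ys' hsub hlt hle hkeys'
      rw [afterMove]
      split_ifs with hs
      · rw [hkeys'.eq_nil (j := j) (by simp) (by simpa using hs)]
        exact (runs_leave A _ _ _ _ hperm).mono (by omega)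
      · refine ih key (hrot.trans hperm) (hinv.rotate hs hsub (hle hs))
          (hkeys'.of_perm hrot.symm) ?_
        have := potential_rotate_lt (hperm.mem_iff.2 hj₀) hlt
        have := hrot.length_eq
        omega
    have hne := hinv.ne_nil j (by simp)
    by_cases hx : (l j).headD 0 = x'
    · obtain ⟨ys', rfl⟩ := hkeys.eq_cons hinv hx
      have hall : ∀ i ∈ js, (l i).headD 0 = x' := fun i hi =>
        hinv.headD_eq hx i (hperm.mem_iff.2 hi)
      have hmove := move x' (l j).tail ys' (List.tail_sublist _) (length_tail_lt hne)
        (hinv.le_headD_tail hx) (hkeys.next hinv hx)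
      have hrun := (((runs_search_hit A base fs l rest key hj hx).trans
        (hres _ l x' hall)).trans (runs_advance A base fs l rest x' hj)).trans hmove
      simpa only [List.flatMap_cons, List.nil_append, List.append_nil] using hrun.mono (by
        simp only [List.map_cons, List.sum_cons]; omega)
    · have hmove := move key _ ys (List.dropWhile_sublist _)
        (length_dropWhile_lt hne (lt_of_le_of_ne (hinv.le j (by simp)) hx))
        (fun h => le_headD_dropWhile h 0) (hkeys.seek hinv)
      exact ((runs_search_seek A base fs l rest key hj hx).trans hmove).mono (by omega)

/-! ### The search tree -/

/-- The path in the trie of the atom `j` that belongs to the bindings `p` of the first variables.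
Both have the deepest key first. -/
def triePath (j : Fin Q.numAtoms) : List ℕ → List ℕ
  | [] => []
  | y :: p => if j ∈ atomsAt Q p.length then y :: triePath j p else triePath j p

/-- The keys that the atom `j` offers for the next variable after the bindings `p`. -/
def children (A : Q.Instance) (j : Fin Q.numAtoms) (p : List ℕ) : List ℕ :=
  trieChildren (A j) (triePath j p).reverse

/-- The keys for the next variable on which all its atoms agree, in increasing order. They are the
edges from the node `p` of the search tree. -/
def commonKeys (A : Q.Instance) (p : List ℕ) : List ℕ :=
  ((Finset.univ.biUnion fun j => (children A j p).toFinset).filter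
    fun y => ∀ j ∈ atomsAt Q p.length, y ∈ children A j p).sort (· ≤ ·)

/-- The least number of keys that an atom offers for the next variable. The leapfrog join at the
node `p` makes at most this number of rounds. -/
noncomputable def minChildren (A : Q.Instance) (p : List ℕ) : ℕ :=
  ⨅ j : {j // j ∈ atomsAt Q p.length}, (children A j p).length

/-- The descendants of the node `p` of the search tree which lie `m` levels below it. -/
def descendants (A : Q.Instance) : ℕ → List ℕ → List (List ℕ)
  | 0, p => [p]
  | m + 1, p => (commonKeys A p).flatMap fun y => descendants A m (y :: p)

/-- The assignment with the bindings `p` of the first variables, deepest first, and zeros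
elsewhere. -/
def assignmentOf (Q : JoinQuery) (p : List ℕ) : Q.Assignment := fun v => p.reverse.getD v 0

/-- A bound for the number of events per node of the search tree, and per round of the leapfrog
join at the node. -/
def nodeCost (Q : JoinQuery) : ℕ := Q.numAtoms ^ 2 + 6 * Q.numAtoms + 2

/-- A bound for the number of events between finding the node `p`, with `m` variables left to bind,
and the move to the next key. -/
noncomputable def work (A : Q.Instance) : ℕ → List ℕ → ℕ
  | 0, _ => 2
  | m + 1, p => 1 + nodeCost Q * (1 + minChildren A p) +
      ((commonKeys A p).map fun y => work A m (y :: p)).sum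

lemma nodup_atomsAt (d : ℕ) : (atomsAt Q d).Nodup := (List.nodup_finRange _).filter _

lemma length_atomsAt_le (d : ℕ) : (atomsAt Q d).length ≤ Q.numAtoms :=
  (List.length_filter_le _ _).trans List.length_finRange.le

lemma mem_atomsAt {d : ℕ} {j : Fin Q.numAtoms} :
    j ∈ atomsAt Q d ↔ ∃ e, (Q.args j e : ℕ) = d := by
  simp [atomsAt]

lemma exists_mem_atomsAt {d : ℕ} (hd : d < Q.numVars) : ∃ j, j ∈ atomsAt Q d := by
  obtain ⟨j, e, h⟩ := Q.covers ⟨d, hd⟩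
  exact ⟨j, mem_atomsAt.2 ⟨e, by rw [h]⟩⟩

lemma sorted_children (A : Q.Instance) (j : Fin Q.numAtoms) (p : List ℕ) :
    (children A j p).Pairwise (· < ·) :=
  (Finset.sortedLT_sort _).pairwise

lemma isCommonKeys_commonKeys (A : Q.Instance) {p : List ℕ} (hp : p.length < Q.numVars) :
    IsCommonKeys (fun j => children A j p) (atomsAt Q p.length) (commonKeys A p) := by
  refine ⟨(Finset.sortedLT_sort _).pairwise, fun y => ?_⟩
  obtain ⟨j, hj⟩ := exists_mem_atomsAt hp
  simp only [commonKeys, Finset.mem_sort, Finset.mem_filter, Finset.mem_biUnion, Finset.mem_univ,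
    true_and, List.mem_toFinset, and_iff_right_iff_imp]
  exact fun h => ⟨j, h j hj⟩

lemma exists_length_children_eq_minChildren (A : Q.Instance) {p : List ℕ}
    (hp : p.length < Q.numVars) :
    ∃ j ∈ atomsAt Q p.length, (children A j p).length = minChildren A p := by
  obtain ⟨j, hj⟩ := exists_mem_atomsAt hp
  have : Nonempty {j // j ∈ atomsAt Q p.length} := ⟨⟨j, hj⟩⟩
  obtain ⟨⟨i, hi⟩, h⟩ := exists_eq_ciInf_of_finite
    (f := fun j : {j // j ∈ atomsAt Q p.length} => (children A j p).length)
  exact ⟨i, hi, h⟩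

lemma minChildren_le (A : Q.Instance) {p : List ℕ} {j : Fin Q.numAtoms}
    (hj : j ∈ atomsAt Q p.length) : minChildren A p ≤ (children A j p).length :=
  ciInf_le' (fun j : {j // j ∈ atomsAt Q p.length} => (children A j p).length) ⟨j, hj⟩

lemma descendants_succ' (A : Q.Instance) (m : ℕ) (p : List ℕ) :
    descendants A (m + 1) p =
      (descendants A m p).flatMap fun p' => (commonKeys A p').map (· :: p') := by
  induction m generalizing p with
  | zero => simp [descendants, List.map_eq_flatMap]
  | succ m ih => rw [descendants, descendants, List.flatMap_assoc]; simp only [ih]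

/-! ### The traversal of the search tree -/

/-- The trie iterators are positioned at the node of the search tree which is given by the keys of
the frames `fs`. -/
def AtNode (iters : Fin Q.numAtoms → TrieIter) (fs : List (Frame Q)) : Prop :=
  ∀ j, (iters j).map (fun l => l.headD 0) = triePath j (fs.map Frame.key)

section Traversal

variable {A : Q.Instance} {iters : Fin Q.numAtoms → TrieIter} {fs : List (Frame Q)}

lemma AtNode.descend (h : AtNode iters fs) (A : Q.Instance) (js : List (Fin Q.numAtoms))
    (j : Fin Q.numAtoms) : (if j ∈ js then (iters j).descend (A j) else iters j) =
      openIters js iters (fun j => children A j (fs.map Frame.key)) j := by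
  simp only [openIters, TrieIter.descend, children, h j]

lemma AtNode.cons (h : AtNode iters fs) {l : Fin Q.numAtoms → List ℕ} {f : Frame Q}
    (hl : ∀ j ∈ atomsAt Q fs.length, (l j).headD 0 = f.key) :
    AtNode (openIters (atomsAt Q fs.length) iters l) (f :: fs) := by
  intro j
  simp only [openIters, List.map_cons, triePath, List.length_map]
  split_ifs with hj
  · rw [List.map_cons, h j, hl j hj]
  · exact h j

lemma any_atEnd_openIters (js : List (Fin Q.numAtoms)) (l : Fin Q.numAtoms → List ℕ) :
    (js.any fun j => (openIters js iters l j).atEnd) = true ↔ ∃ j ∈ js, l j = [] := by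
  rw [List.any_eq_true]
  refine exists_congr fun j => and_congr_right fun hj => ?_
  simp [openIters_of_mem hj, TrieIter.atEnd]

lemma runs_enter_leave (h : AtNode iters fs)
    (hempty : ∃ j ∈ atomsAt Q fs.length, children A j (fs.map Frame.key) = []) :
    Runs A ⟨iters, fs, .enter⟩ (afterLeave iters fs) []
      (3 * (atomsAt Q fs.length).length + 1) := by
  set js := atomsAt Q fs.length with hjs
  set l := fun j => children A j (fs.map Frame.key) with hl
  have hany := (any_atEnd_openIters (iters := iters) js l).2 hempty
  have hstep : Runs A ⟨iters, fs, .enter⟩ ⟨openIters js iters l, ⟨js, 0⟩ :: fs, .leave⟩ []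
      (2 * js.length) := by
    refine .of_step (evs := js.map (fun j => .iter j .descend) ++ js.map (fun j => .iter j .atEnd))
      (fun tr => ?_) (by simp [output]) (by simp [two_mul])
    simp only [step, stepEnter, State.withTrace, h.descend, ← hjs, ← hl, hany, if_true,
      List.append_assoc]
  exact (hstep.trans (runs_leave A _ _ _ _ (.refl js))).mono (by omega)

lemma runs_enter_search (h : AtNode iters fs) (hfs : fs.length < Q.numVars)
    (hne : ∀ j ∈ atomsAt Q fs.length, children A j (fs.map Frame.key) ≠ []) :
    ∃ queue x', queue.Perm (atomsAt Q fs.length) ∧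
      JoinInv (fun j => children A j (fs.map Frame.key)) queue x' ∧
      Runs A ⟨iters, fs, .enter⟩
        ⟨openIters (atomsAt Q fs.length) iters fun j => children A j (fs.map Frame.key),
          ⟨queue, 0⟩ :: fs, .search x'⟩ []
        ((atomsAt Q fs.length).length ^ 2 + 3 * (atomsAt Q fs.length).length + 1) := by
  set js := atomsAt Q fs.length with hjs
  set l := fun j => children A j (fs.map Frame.key) with hl
  set queue := js.insertionSort fun i j =>
    (openIters js iters l i).key ≤ (openIters js iters l j).key with hqueue
  have hkey : ∀ j ∈ js, (openIters js iters l j).key = (l j).headD 0 := fun j hj => by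
    simp [openIters_of_mem hj, TrieIter.key]
  have hperm : queue.Perm js := List.perm_insertionSort _ _
  have hany : (js.any fun j => (openIters js iters l j).atEnd) = false := by
    rw [Bool.eq_false_iff, Ne, any_atEnd_openIters]
    push Not
    exact hne
  obtain ⟨j, hj⟩ := exists_mem_atomsAt hfs
  obtain ⟨init, last, hsplit⟩ := List.eq_nil_or_concat queue |>.resolve_left
    (List.ne_nil_of_mem (hperm.mem_iff.2 hj))
  have hlast : queue.getLast? = some last := by simp [hsplit]
  refine ⟨queue, (openIters js iters l last).key, hperm, joinInv_insertionSort
    (key := fun j => (openIters js iters l j).key) (nodup_atomsAt _)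
    (fun j _ => sorted_children A j _) hne hkey hlast, ?_⟩
  refine Runs.of_step (evs := js.map (fun j => .iter j .descend) ++
    js.map (fun j => .iter j .atEnd) ++ js.map (fun j => .iter j .key) ++
    List.replicate (js.length ^ 2) .ram ++ [.iter last .key]) (fun tr => ?_) ?_ ?_
  · simp only [step, stepEnter, State.withTrace, h.descend, ← hjs, hany, Bool.false_eq_true,
      if_false, ← hl]
    simp only [← hqueue, hlast, Option.map_some, Option.getD_some, Option.toList_some,
      List.map_cons, List.map_nil, List.append_assoc]
  · simp [output]
  · simp only [List.length_append, List.length_map, List.length_replicate, List.length_singleton]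
    omega

lemma runs_enter (h : AtNode iters fs) (hfs : fs.length < Q.numVars)
    {sub : ℕ → List Q.Assignment} {w : ℕ → ℕ}
    (hres : ∀ queue l x, (∀ j ∈ atomsAt Q fs.length, (l j).headD 0 = x) →
      Runs A ⟨openIters (atomsAt Q fs.length) iters l, ⟨queue, x⟩ :: fs, .result⟩
        ⟨openIters (atomsAt Q fs.length) iters l, ⟨queue, x⟩ :: fs, .advance⟩ (sub x) (w x)) :
    Runs A ⟨iters, fs, .enter⟩ (afterLeave iters fs)
      ((commonKeys A (fs.map Frame.key)).flatMap sub)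
      (nodeCost Q * (1 + minChildren A (fs.map Frame.key)) +
        ((commonKeys A (fs.map Frame.key)).map w).sum) := by
  have hlen : (fs.map Frame.key).length = fs.length := List.length_map _
  have hkeys := isCommonKeys_commonKeys A (hlen.trans_lt hfs)
  have hatoms := length_atomsAt_le (Q := Q) fs.length
  rw [hlen] at hkeys
  by_cases hempty : ∃ j ∈ atomsAt Q fs.length, children A j (fs.map Frame.key) = []
  · obtain ⟨j, hj, hnil⟩ := hempty
    rw [hkeys.eq_nil hj hnil]
    refine (runs_enter_leave h ⟨j, hj, hnil⟩).mono (le_add_right ?_)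
    exact le_trans (by rw [nodeCost]; nlinarith) (Nat.le_mul_of_pos_right _ (by omega))
  · push Not at hempty
    obtain ⟨queue, x', hperm, hinv, hrun⟩ := runs_enter_search h hfs hempty
    obtain ⟨j₀, hj₀, hmin⟩ := exists_length_children_eq_minChildren A (hlen.trans_lt hfs)
    rw [hlen] at hj₀
    refine (hrun.trans (runs_search hres hj₀
      ((atomsAt Q fs.length).length * minChildren A (fs.map Frame.key)) 0 hperm hinv
      (hkeys.of_perm hperm.symm) ?_)).mono ?_
    · have hidx := List.idxOf_lt_length_iff.2 (hperm.mem_iff.2 hj₀)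
      rw [potential, hmin, ← hperm.length_eq]
      omega
    · have hmul := Nat.mul_le_mul_right (minChildren A (fs.map Frame.key)) hatoms
      have hsq := Nat.pow_le_pow_left hatoms 2
      rw [nodeCost]
      nlinarith [Nat.zero_le (Q.numAtoms ^ 2 * minChildren A (fs.map Frame.key))]

lemma runs_result (m : ℕ) {f : Frame Q} (h : AtNode iters (f :: fs))
    (hfs : (f :: fs).length + m = Q.numVars) :
    Runs A ⟨iters, f :: fs, .result⟩ ⟨iters, f :: fs, .advance⟩
      ((descendants A m ((f :: fs).map Frame.key)).map (assignmentOf Q))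
      (work A m ((f :: fs).map Frame.key)) := by
  induction m generalizing iters f fs with
  | zero =>
    refine .of_step (evs := [.ram, .emit (currentAssignment (f :: fs))]) (fun tr => ?_) rfl le_rfl
    simp only [step, stepResult, State.withTrace, show (f :: fs).length = Q.numVars from hfs,
      if_true]
  | succ m ih =>
    have hlt : (f :: fs).length < Q.numVars := by omega
    have hstep : Runs A ⟨iters, f :: fs, .result⟩ ⟨iters, f :: fs, .enter⟩ [] 1 := by
      refine .of_step (evs := [.ram]) (fun tr => ?_) rfl le_rfl
      simp only [step, stepResult, State.withTrace, hlt.ne, if_false]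
    have henter := runs_enter h hlt
      (sub := fun x => (descendants A m (x :: (f :: fs).map Frame.key)).map (assignmentOf Q))
      (w := fun x => work A m (x :: (f :: fs).map Frame.key))
      fun queue l x hl => ih (f := ⟨queue, x⟩) (h.cons hl) (by rw [List.length_cons]; omega)
    rw [work, descendants, List.map_flatMap, add_assoc]
    exact hstep.trans henter

end Traversal

theorem exists_leapfrogTriejoin (A : Q.Instance) :
    ∃ tr, LeapfrogTriejoin A tr ∧
      output tr = (descendants A Q.numVars []).map (assignmentOf Q) ∧
      tr.length ≤ work A Q.numVars [] := by
  obtain ⟨m, hm⟩ := Nat.exists_eq_add_one.2 Q.numVars_pos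
  have hroot : AtNode (Q := Q) (fun _ => []) [] := fun _ => rfl
  obtain ⟨evs, hout, hlen, hreach⟩ := runs_enter hroot Q.numVars_pos
    (sub := fun x => (descendants A m [x]).map (assignmentOf Q)) (w := fun x => work A m [x])
    fun queue l x hl =>
      runs_result m (f := ⟨queue, x⟩) (hroot.cons hl) (by rw [List.length_singleton]; omega)
  obtain ⟨t, ht⟩ := hreach []
  refine ⟨evs, ⟨t, ?_⟩, ?_, ?_⟩
  · have ht' : (step A)^[t] (initConfig Q) = (afterLeave _ []).withTrace ([] ++ evs) := ht
    rw [ht']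
    exact ⟨rfl, rfl⟩
  · rw [hout, hm, descendants, List.map_flatMap]
    rfl
  · rw [hm, work]
    exact hlen.trans (by simp only [List.map_nil]; omega)

lemma iterate_step_of_done {A : Q.Instance} {c : Config Q} (hc : c.phase = .done) (t : ℕ) :
    (step A)^[t] c = c :=
  Function.iterate_fixed (by simp [step, hc]) t

lemma LeapfrogTriejoin.unique {A : Q.Instance} {tr tr' : List (Event Q)}
    (h : LeapfrogTriejoin A tr) (h' : LeapfrogTriejoin A tr') : tr = tr' := by
  obtain ⟨t, hdone, rfl⟩ := h
  obtain ⟨t', hdone', rfl⟩ := h'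
  wlog ht : t ≤ t' generalizing t t'
  · exact (this t' hdone' t hdone (le_of_not_ge ht)).symm
  obtain ⟨s, rfl⟩ := Nat.exists_eq_add_of_le' ht
  rw [Function.iterate_add_apply, iterate_step_of_done hdone]

/-! ### The nodes of the search tree -/

section Siblings

variable {ι α : Type*} [Fintype ι] [LinearOrder ι] [DecidableEq α]

/-- The values at the position `e` of the tuples in `R` which agree with `s` before `e`. In the
trie of `R` these are the children of the node reached along `s`. -/
def siblings (R : Finset (ι → α)) (s : ι → α) (e : ι) : Finset α :=
  (R.filter fun t => ∀ e' < e, t e' = s e').image (· e)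

lemma mem_siblings {R : Finset (ι → α)} {s : ι → α} {e : ι} {y : α} :
    y ∈ siblings R s e ↔ ∃ t ∈ R, (∀ e' < e, t e' = s e') ∧ t e = y := by
  simp [siblings, and_assoc]

lemma siblings_congr {R : Finset (ι → α)} {s s' : ι → α} {e : ι} (h : ∀ e' < e, s e' = s' e') :
    siblings R s e = siblings R s' e := by
  ext y
  simp only [mem_siblings]
  exact exists_congr fun t => and_congr_right fun _ => and_congr_left fun _ =>
    forall₂_congr fun e' he' => by rw [h e' he']

end Siblings

lemma take_ofFn_eq_take_ofFn_iff {α : Type*} {n k : ℕ} {t u : Fin n → α} :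
    (List.ofFn t).take k = (List.ofFn u).take k ↔ ∀ i : Fin n, (i : ℕ) < k → t i = u i := by
  refine ⟨fun h i hi => ?_, fun h => List.ext_getElem (by simp) fun i hi _ => ?_⟩
  · have hget := congrArg (·[(i : ℕ)]?) h
    simpa [List.getElem?_take_of_lt hi] using hget
  · rw [List.length_take, List.length_ofFn, lt_min_iff] at hi
    simpa using h ⟨i, hi.2⟩ hi.1

lemma trieChildren_take_ofFn {a : ℕ} (R : Finset (Fin a → ℕ)) (s : Fin a → ℕ) (e : Fin a) :
    trieChildren R ((List.ofFn s).take e) = (siblings R s e).sort (· ≤ ·) := by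
  have hlen : ((List.ofFn s).take e).length = e := by simp
  rw [trieChildren]
  congr 1
  ext y
  simp [hlen, mem_siblings, take_ofFn_eq_take_ofFn_iff, and_assoc]

lemma assignmentOf_cons (r : ℕ) (p : List ℕ) (v : Fin Q.numVars) :
    assignmentOf Q (r :: p) v =
      if (v : ℕ) < p.length then assignmentOf Q p v else if (v : ℕ) = p.length then r else 0 := by
  rw [assignmentOf, List.reverse_cons]
  split_ifs with hlt heq
  · exact List.getD_append _ _ _ _ (by simpa using hlt)
  · rw [List.getD_append_right _ _ _ _ (by simp [heq])]
    simp [heq]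
  · exact List.getD_eq_default _ _ (by simp; omega)

lemma assignmentOf_injOn {n : ℕ} (hn : n ≤ Q.numVars) :
    Set.InjOn (assignmentOf Q) {p | p.length = n} := by
  intro p (hp : _ = _) p' (hp' : _ = _) h
  refine List.reverse_injective (List.ext_getElem (by simp [hp, hp']) fun i hi hi' => ?_)
  have hget := congrFun h ⟨i, by simp at hi; omega⟩
  simpa only [assignmentOf, List.getD_eq_getElem _ _ hi, List.getD_eq_getElem _ _ hi'] using hget

lemma assignmentOf_reverse_ofFn (x : Q.Assignment) :
    assignmentOf Q (List.ofFn x).reverse = x := by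
  funext v
  simp [assignmentOf]

lemma args_lt_args {j : Fin Q.numAtoms} {e e' : Fin (Q.arity j)} :
    (Q.args j e : ℕ) < Q.args j e' ↔ e < e' := (Q.args j).lt_iff_lt

lemma reverse_triePath {j : Fin Q.numAtoms} {p : List ℕ} {k : ℕ} (hk : k ≤ Q.arity j)
    (h : ∀ e : Fin (Q.arity j), (Q.args j e : ℕ) < p.length ↔ (e : ℕ) < k) :
    (triePath j p).reverse =
      (List.ofFn fun e => assignmentOf Q p (Q.args j e)).take k := by
  induction p generalizing k with
  | nil =>
    have hzero : k = 0 := by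
      by_contra hne
      simpa using (h ⟨0, by omega⟩).2 (Nat.pos_of_ne_zero hne)
    simp [triePath, hzero]
  | cons y p ih =>
    rw [List.length_cons] at h
    have hold : ∀ {i : ℕ}, (∀ e : Fin (Q.arity j), (e : ℕ) < i → (Q.args j e : ℕ) < p.length) →
        (List.ofFn fun e => assignmentOf Q p (Q.args j e)).take i =
          (List.ofFn fun e => assignmentOf Q (y :: p) (Q.args j e)).take i := fun hi =>
      take_ofFn_eq_take_ofFn_iff.2 fun e he => by rw [assignmentOf_cons, if_pos (hi e he)]
    by_cases hj : j ∈ atomsAt Q p.length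
    · obtain ⟨e, he⟩ := mem_atomsAt.1 hj
      have hbefore : ∀ e' : Fin (Q.arity j), (Q.args j e' : ℕ) < p.length ↔ (e' : ℕ) < e :=
        fun e' => he ▸ args_lt_args
      have hke : k = e + 1 := by
        refine le_antisymm (not_lt.1 fun hlt => ?_) ((h e).1 (by omega))
        have hnext := (h ⟨e + 1, by omega⟩).2 hlt
        have hgt : e < ⟨e + 1, by omega⟩ := Fin.lt_def.2 (Nat.lt_succ_self _)
        have := args_lt_args.2 hgt
        omega
      rw [triePath, if_pos hj, List.reverse_cons, ih e.2.le hbefore,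
        hold fun e' => (hbefore e').2, hke, List.take_add_one]
      simp [assignmentOf_cons, he]
    · have hne : ∀ e, (Q.args j e : ℕ) ≠ p.length := fun e he => hj (mem_atomsAt.2 ⟨e, he⟩)
      have hbefore : ∀ e : Fin (Q.arity j), (Q.args j e : ℕ) < p.length ↔ (e : ℕ) < k :=
        fun e => ⟨fun hlt => (h e).1 (by omega),
          fun hlt => lt_of_le_of_ne (Nat.lt_succ_iff.1 ((h e).2 hlt)) (hne e)⟩
      rw [triePath, if_neg hj, ih hk hbefore, hold fun e => (hbefore e).2]

lemma children_eq_sort_siblings (A : Q.Instance) {j : Fin Q.numAtoms} {e : Fin (Q.arity j)}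
    {p : List ℕ} (he : (Q.args j e : ℕ) = p.length) :
    children A j p =
      (siblings (A j) (fun e' => assignmentOf Q p (Q.args j e')) e).sort (· ≤ ·) := by
  rw [children, reverse_triePath e.2.le fun e' => he ▸ args_lt_args, trieChildren_take_ofFn]

lemma mem_commonKeys {A : Q.Instance} {p : List ℕ} {y : ℕ} (hp : p.length < Q.numVars) :
    y ∈ commonKeys A p ↔ ∀ j e, (Q.args j e : ℕ) = p.length →
      y ∈ siblings (A j) (fun e' => assignmentOf Q p (Q.args j e')) e := by
  rw [(isCommonKeys_commonKeys A hp).2]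
  simp only [mem_atomsAt, forall_exists_index]
  exact forall₃_congr fun j e he => by rw [children_eq_sort_siblings A he, Finset.mem_sort]

/-- The values of `x` on the variables before `d` are consistent with each single atom that contains
such a variable. These are the nodes of the search tree; the values of `x` on the other variables
are irrelevant. -/
def IsPartialAnswer (A : Q.Instance) (d : ℕ) (x : Q.Assignment) : Prop :=
  ∀ j, (∃ e, (Q.args j e : ℕ) < d) → ∃ t ∈ A j, ∀ e, (Q.args j e : ℕ) < d → t e = x (Q.args j e)

lemma isPartialAnswer_zero (A : Q.Instance) (x : Q.Assignment) : IsPartialAnswer A 0 x :=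
  fun _ ⟨_, he⟩ => absurd he (Nat.not_lt_zero _)

lemma isPartialAnswer_numVars_iff_mem_answers {A : Q.Instance} {x : Q.Assignment} :
    IsPartialAnswer A Q.numVars x ↔ x ∈ answers A := by
  refine forall_congr' fun j => ⟨fun h => ?_, fun h _ => ⟨_, h, fun _ _ => rfl⟩⟩
  obtain ⟨t, ht, heq⟩ := h ⟨⟨0, Q.arity_pos j⟩, (Q.args j _).2⟩
  rwa [← show t = _ from funext fun e => heq e (Q.args j e).2]

lemma isPartialAnswer_cons {A : Q.Instance} {p : List ℕ} (hp : p.length < Q.numVars) {y : ℕ} :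
    IsPartialAnswer A (p.length + 1) (assignmentOf Q (y :: p)) ↔
      IsPartialAnswer A p.length (assignmentOf Q p) ∧ y ∈ commonKeys A p := by
  have hold : ∀ {v : Fin Q.numVars}, (v : ℕ) < p.length →
      assignmentOf Q (y :: p) v = assignmentOf Q p v := fun hv => by
    rw [assignmentOf_cons, if_pos hv]
  have hnew : ∀ {v : Fin Q.numVars}, (v : ℕ) = p.length → assignmentOf Q (y :: p) v = y :=
    fun hv => by rw [assignmentOf_cons, if_neg hv.not_lt, if_pos hv]
  rw [mem_commonKeys hp]
  constructor
  · refine fun h => ⟨fun j ⟨e, he⟩ => ?_, fun j e he => mem_siblings.2 ?_⟩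
    · obtain ⟨t, ht, heq⟩ := h j ⟨e, by omega⟩
      exact ⟨t, ht, fun e' he' => by rw [heq e' (by omega), hold he']⟩
    · obtain ⟨t, ht, heq⟩ := h j ⟨e, by omega⟩
      refine ⟨t, ht, fun e' he' => ?_, by rw [heq e (by omega), hnew he]⟩
      have hlt : (Q.args j e' : ℕ) < p.length := he ▸ args_lt_args.2 he'
      rw [heq e' (by omega), hold hlt]
  · rintro ⟨hprev, hy⟩ j ⟨e₀, he₀⟩
    by_cases hj : ∃ e, (Q.args j e : ℕ) = p.length
    · obtain ⟨e, he⟩ := hj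
      obtain ⟨t, ht, hbefore, hat⟩ := mem_siblings.1 (hy j e he)
      refine ⟨t, ht, fun e' he' => ?_⟩
      rcases (Nat.lt_succ_iff.1 he').lt_or_eq with hlt | heq
      · rw [hold hlt, hbefore e' (args_lt_args.1 (he ▸ hlt))]
      · rw [hnew heq, (Q.args j).injective (Fin.ext (heq.trans he.symm)), hat]
    · push Not at hj
      have hlt : ∀ {e}, (Q.args j e : ℕ) < p.length + 1 → (Q.args j e : ℕ) < p.length :=
        fun {e} he => lt_of_le_of_ne (Nat.lt_succ_iff.1 he) (hj e)
      obtain ⟨t, ht, heq⟩ := hprev j ⟨e₀, hlt he₀⟩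
      exact ⟨t, ht, fun e he => by rw [heq e (hlt he), hold (hlt he)]⟩

lemma mem_descendants {A : Q.Instance} {d : ℕ} (hd : d ≤ Q.numVars) {p : List ℕ} :
    p ∈ descendants A d [] ↔ p.length = d ∧ IsPartialAnswer A d (assignmentOf Q p) := by
  induction d generalizing p with
  | zero => simpa [descendants] using fun _ => isPartialAnswer_zero A _
  | succ d ih =>
    simp only [descendants_succ', List.mem_flatMap, List.mem_map, ih (Nat.le_of_succ_le hd)]
    constructor
    · rintro ⟨p, ⟨rfl, hp⟩, y, hy, rfl⟩
      exact ⟨rfl, (isPartialAnswer_cons hd).2 ⟨hp, hy⟩⟩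
    · rintro ⟨hlen, hp⟩
      obtain ⟨y, p, rfl⟩ := List.exists_cons_of_length_eq_add_one hlen
      obtain rfl : p.length = d := Nat.succ_injective hlen
      obtain ⟨hprev, hy⟩ := (isPartialAnswer_cons hd).1 hp
      exact ⟨p, ⟨rfl, hprev⟩, y, hy, rfl⟩

lemma nodup_flatMap_map_cons {α : Type*} {L : List (List α)} {K : List α → List α}
    (hL : L.Nodup) (hK : ∀ p, (K p).Nodup) : (L.flatMap fun p => (K p).map (· :: p)).Nodup := by
  refine List.nodup_flatMap.2 ⟨fun p _ => (hK p).map fun y y' h => (List.cons.inj h).1,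
    hL.imp fun hne z hz hz' => hne ?_⟩
  obtain ⟨y, -, rfl⟩ := List.mem_map.1 hz
  obtain ⟨y', -, h⟩ := List.mem_map.1 hz'
  exact (List.cons.inj h).2.symm

lemma nodup_descendants (A : Q.Instance) (d : ℕ) : (descendants A d []).Nodup := by
  induction d with
  | zero => exact List.nodup_singleton _
  | succ d ih =>
    rw [descendants_succ']
    exact nodup_flatMap_map_cons ih fun p => Finset.sort_nodup _ _

theorem mem_map_assignmentOf_descendants {A : Q.Instance} {x : Q.Assignment} :
    x ∈ (descendants A Q.numVars []).map (assignmentOf Q) ↔ x ∈ answers A := by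
  simp only [List.mem_map, mem_descendants le_rfl, isPartialAnswer_numVars_iff_mem_answers]
  constructor
  · rintro ⟨p, ⟨-, hp⟩, rfl⟩
    exact hp
  · exact fun hx => ⟨(List.ofFn x).reverse, ⟨by simp, by rwa [assignmentOf_reverse_ofFn]⟩,
      assignmentOf_reverse_ofFn x⟩

theorem nodup_map_assignmentOf_descendants (A : Q.Instance) :
    ((descendants A Q.numVars []).map (assignmentOf Q)).Nodup :=
  (nodup_descendants A _).map_on fun _ hp _ hp' =>
    assignmentOf_injOn le_rfl ((mem_descendants le_rfl).1 hp).1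
      ((mem_descendants le_rfl).1 hp').1

/-! ### Renumbering -/

section RenumberTuple

variable {ι κ V : Type*} [Fintype ι] [LinearOrder ι] [Fintype κ] [LinearOrder κ] [LinearOrder V]
  {R : Finset (ι → ℕ)} {v : ι ↪o V} {d : V}

/-- The renumbering of a tuple `s` of the relation `R`, whose columns belong to the variables `v`:
the value of the variable `d` is replaced by its rank among its siblings, and the later ones
by `0`. -/
def renumberTuple (R : Finset (ι → ℕ)) (v : ι ↪o V) (d : V) (s : ι → ℕ) (e : ι) : ℕ :=
  if v e < d then s e else if v e = d then Nat.count (· ∈ siblings R s e) (s e) else 0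

lemma exists_renumberTuple_eq {s : ι → ℕ} {r : ℕ} (hs : ∃ t ∈ R, ∀ e, v e < d → t e = s e)
    (hr : ∀ e, v e = d → r < (siblings R s e).card) :
    ∃ t ∈ R, renumberTuple R v d t =
      fun e => if v e < d then s e else if v e = d then r else 0 := by
  by_cases hd : ∃ e, v e = d
  · obtain ⟨e, rfl⟩ := hd
    have hcard : r < (siblings R s e).finite_toSet.toFinset.card := by simpa using hr e rfl
    obtain ⟨t, ht, hbefore, hat⟩ := mem_siblings.1 (Nat.nth_mem_of_lt_card _ hcard)
    refine ⟨t, ht, funext fun e' => ?_⟩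
    simp only [renumberTuple, v.lt_iff_lt, v.eq_iff_eq]
    split_ifs with hlt heq
    · exact hbefore e' hlt
    · rw [heq, siblings_congr hbefore, hat]
      exact Nat.count_nth fun hfin => by simpa using hcard
    · rfl
  · push Not at hd
    obtain ⟨t, ht, heq⟩ := hs
    refine ⟨t, ht, funext fun e => ?_⟩
    simp only [renumberTuple, hd e, if_false]
    split_ifs with hlt
    · exact heq e hlt
    · rfl

lemma siblings_subset_siblings_image_comp (f : κ ↪o ι) (s : ι → ℕ) (e : κ) :
    siblings R s (f e) ⊆ siblings (R.image (· ∘ f)) (s ∘ f) e := by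
  intro y hy
  obtain ⟨t, ht, hbefore, hat⟩ := mem_siblings.1 hy
  exact mem_siblings.2
    ⟨t ∘ f, Finset.mem_image_of_mem _ ht, fun e' he' => hbefore _ (f.lt_iff_lt.2 he'), hat⟩

lemma count_siblings_lt_card {s : ι → ℕ} (hs : s ∈ R) (e : ι) :
    Nat.count (· ∈ siblings R s e) (s e) < (siblings R s e).card := by
  simpa using Nat.count_lt_card (p := (· ∈ siblings R s e)) (siblings R s e).finite_toSet
    (mem_siblings.2 ⟨s, hs, fun _ _ => rfl, rfl⟩)

/-- A tuple has at most as many siblings as its projection, so that its rank is also the rank of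
some sibling of the projection. -/
lemma image_comp_image_renumberTuple_subset (f : κ ↪o ι) :
    (R.image (renumberTuple R v d)).image (· ∘ f) ⊆
      (R.image (· ∘ f)).image (renumberTuple (R.image (· ∘ f)) (f.trans v) d) := by
  simp only [Finset.image_subset_iff, Finset.forall_mem_image]
  intro s hs
  obtain ⟨r, hr⟩ : ∃ r, ∀ e, v (f e) = d → Nat.count (· ∈ siblings R s (f e)) (s (f e)) = r ∧
      r < (siblings (R.image (· ∘ f)) (s ∘ f) e).card := by
    by_cases hd : ∃ e, v (f e) = d
    · obtain ⟨e, rfl⟩ := hd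
      refine ⟨Nat.count (· ∈ siblings R s (f e)) (s (f e)), fun e' he' => ?_⟩
      obtain rfl : e' = e := f.injective (v.injective he')
      exact ⟨rfl, (count_siblings_lt_card hs _).trans_le
        (Finset.card_le_card (siblings_subset_siblings_image_comp f s e'))⟩
    · exact ⟨0, fun e he => absurd ⟨e, he⟩ hd⟩
  obtain ⟨t, ht, heq⟩ := exists_renumberTuple_eq (R := R.image (· ∘ f)) (v := f.trans v) (d := d)
    (s := s ∘ f) ⟨_, Finset.mem_image_of_mem _ hs, fun _ _ => rfl⟩ fun e he => (hr e he).2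
  refine Finset.mem_image.2 ⟨t, ht, heq.trans (funext fun e => ?_)⟩
  by_cases hat : v (f e) = d
  · simp [renumberTuple, hat, (hr e hat).1]
  · simp [renumberTuple, hat]

end RenumberTuple

/-- The instance in which all relations are renumbered at the variable `d`. An empty relation is
replaced by `{0}`: the search may reach the variable `d` before it looks at that relation. -/
def renumber (A : Q.Instance) (d : Fin Q.numVars) : Q.Instance := fun j =>
  if A j = ∅ then {0} else (A j).image (renumberTuple (A j) (Q.args j) d)

lemma card_proj_renumber_le (A : Q.Instance) (d : Fin Q.numVars) (j : Fin Q.numAtoms)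
    (cols : Finset (Fin (Q.arity j))) :
    (proj (renumber A d) j cols).card ≤ max 1 (proj A j cols).card := by
  by_cases hA : A j = ∅
  · simp [proj, renumber, hA]
  · rw [proj, renumber, if_neg hA]
    exact ((Finset.card_le_card (image_comp_image_renumberTuple_subset
      (OrderEmbedding.subtype (· ∈ cols)))).trans Finset.card_image_le).trans (le_max_right _ _)

lemma mem_answers_renumber {A : Q.Instance} {d : Fin Q.numVars} {x : Q.Assignment} {r : ℕ}
    (hx : IsPartialAnswer A d x)
    (hr : ∀ j e, Q.args j e = d →
      r < max 1 (siblings (A j) (fun e' => x (Q.args j e')) e).card) :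
    (fun v => if v < d then x v else if v = d then r else 0) ∈ answers (renumber A d) := by
  intro j
  by_cases hA : A j = ∅
  · rw [renumber, if_pos hA, Finset.mem_singleton]
    funext e
    simp only [Pi.zero_apply]
    split_ifs with hlt hat
    · obtain ⟨t, ht, -⟩ := hx j ⟨e, hlt⟩
      simp [hA] at ht
    · simpa [hA, siblings] using hr j e hat
    · rfl
  · obtain ⟨t, ht, heq⟩ : ∃ t ∈ A j, ∀ e, Q.args j e < d → t e = x (Q.args j e) := by
      by_cases hlt : ∃ e, (Q.args j e : ℕ) < d
      · exact hx j hlt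
      · obtain ⟨t, ht⟩ := Finset.nonempty_iff_ne_empty.2 hA
        exact ⟨t, ht, fun e he => absurd ⟨e, he⟩ hlt⟩
    rw [renumber, if_neg hA]
    obtain ⟨u, hu, hren⟩ := exists_renumberTuple_eq (v := Q.args j) ⟨t, ht, heq⟩ fun e he => by
      have hpos : 0 < (siblings (A j) (fun e' => x (Q.args j e')) e).card :=
        Finset.card_pos.2 ⟨t e, mem_siblings.2
          ⟨t, ht, fun e' he' => heq e' (he ▸ (Q.args j).lt_iff_lt.2 he'), rfl⟩⟩
      simpa [Nat.one_le_iff_ne_zero.2 hpos.ne'] using hr j e he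
    exact Finset.mem_image.2 ⟨u, hu, hren⟩

/-- The class contains the renumberings of its members at every variable, as do the nontrivial
families defined by cardinality constraints on projections. This is what makes the search-tree
bound worst-case optimal. -/
def ClosedUnderRenumbering (S : Set Q.Instance) : Prop :=
  ∀ A ∈ S, ∀ d, renumber A d ∈ S

theorem ProblemFamily.IsDefinedBy.closedUnderRenumbering {P : Type*} [Preorder P]
    {F : ProblemFamily Q P} {cons : Set (ProjConstraint Q P)} (hF : F.IsDefinedBy cons) {n : P}
    {B : Q.Instance} (hB : B ∈ F.inst n) (hne : (answers B).Nonempty) :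
    ClosedUnderRenumbering (F.inst n) := by
  intro A hA d
  rw [hF] at hA hB ⊢
  intro c hc
  obtain ⟨x, hx⟩ := hne
  have hproj : 1 ≤ (proj B c.atom c.cols).card :=
    Finset.card_pos.2 ⟨_, Finset.mem_image_of_mem _ (hx c.atom)⟩
  have hone : (1 : ℝ) ≤ c.bound n := le_trans (by exact_mod_cast hproj) (hB c hc)
  calc ((proj (renumber A d) c.atom c.cols).card : ℝ)
      ≤ max 1 ((proj A c.atom c.cols).card : ℝ) := by
        exact_mod_cast card_proj_renumber_le A d c.atom c.cols
    _ ≤ c.bound n := max_le hone (hA c hc)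

/-! ### The size of the search tree -/

lemma length_le_encard_of_nodup {α : Type*} {L : List α} {s : Set α} (hL : L.Nodup)
    (h : ∀ x ∈ L, x ∈ s) : (L.length : ℕ∞) ≤ s.encard := by
  classical
  have hsub : (L.toFinset : Set α) ⊆ s := fun x hx => h x (by simpa using hx)
  rw [← List.toFinset_card_of_nodup hL, ← Set.encard_coe_eq_coe_finsetCard]
  exact Set.encard_le_encard hsub

lemma assignmentOf_cons_mem_answers_renumber {A : Q.Instance} {d : Fin Q.numVars} {p : List ℕ}
    {r : ℕ} (hp : p ∈ descendants A d []) (hr : r < max 1 (minChildren A p)) :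
    assignmentOf Q (r :: p) ∈ answers (renumber A d) := by
  obtain ⟨hlen, hpartial⟩ := (mem_descendants d.2.le).1 hp
  have hmem := mem_answers_renumber (r := r) hpartial fun j e he => by
    have he' : (Q.args j e : ℕ) = p.length := by rw [he, hlen]
    have hmin := minChildren_le A (mem_atomsAt.2 ⟨e, he'⟩)
    rw [children_eq_sort_siblings A he', Finset.length_sort] at hmin
    exact hr.trans_le (max_le_max_left 1 hmin)
  convert hmem using 2 with v
  simp only [assignmentOf_cons, hlen, Fin.lt_def, Fin.ext_iff]

lemma sum_max_one_minChildren_le_encard (A : Q.Instance) (d : Fin Q.numVars) :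
    (((descendants A d []).map fun p => max 1 (minChildren A p)).sum : ℕ∞) ≤
      (answers (renumber A d)).encard := by
  set L := (descendants A d []).flatMap fun p =>
    (List.range (max 1 (minChildren A p))).map (· :: p) with hL
  have hmem : ∀ {z}, z ∈ L → ∃ p ∈ descendants A d [], ∃ r < max 1 (minChildren A p),
      r :: p = z := by
    simp only [hL, List.mem_flatMap, List.mem_map, List.mem_range, imp_self, implies_true]
  have hlen : L.length = ((descendants A d []).map fun p => max 1 (minChildren A p)).sum := by
    simp [hL, List.length_flatMap]
  have hlength : ∀ {z}, z ∈ L → z.length = d + 1 := fun hz => by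
    obtain ⟨p, hp, r, -, rfl⟩ := hmem hz
    rw [List.length_cons, ((mem_descendants d.2.le).1 hp).1]
  have hnodup : (L.map (assignmentOf Q)).Nodup :=
    (nodup_flatMap_map_cons (nodup_descendants A d) fun p => List.nodup_range).map_on
      fun z hz z' hz' => assignmentOf_injOn d.2 (hlength hz) (hlength hz')
  rw [← hlen, ← List.length_map (assignmentOf Q)]
  refine length_le_encard_of_nodup hnodup fun x hx => ?_
  obtain ⟨z, hz, rfl⟩ := List.mem_map.1 hx
  obtain ⟨p, hp, r, hr, rfl⟩ := hmem hz
  exact assignmentOf_cons_mem_answers_renumber hp hr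

lemma sum_work_le {A : Q.Instance} {q : ℕ}
    (hnodes : ∀ d : Fin Q.numVars,
      ((descendants A d []).map fun p => max 1 (minChildren A p)).sum ≤ q)
    (hleaves : (descendants A Q.numVars []).length ≤ q) {d m : ℕ} (hd : d + m = Q.numVars) :
    ((descendants A d []).map (work A m)).sum ≤ q * (2 + m * (2 * nodeCost Q + 1)) := by
  induction m generalizing d with
  | zero =>
    obtain rfl : d = Q.numVars := hd
    simpa [work] using hleaves
  | succ m ih =>
    have hnode : ∀ p, 1 + nodeCost Q * (1 + minChildren A p) ≤
        (2 * nodeCost Q + 1) * max 1 (minChildren A p) := fun p => by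
      nlinarith [Nat.mul_le_mul_left (nodeCost Q) (le_max_left 1 (minChildren A p)),
        Nat.mul_le_mul_left (nodeCost Q) (le_max_right 1 (minChildren A p)),
        le_max_left 1 (minChildren A p)]
    calc ((descendants A d []).map (work A (m + 1))).sum
        = ((descendants A d []).map fun p => 1 + nodeCost Q * (1 + minChildren A p)).sum +
            ((descendants A (d + 1) []).map (work A m)).sum := by
          rw [descendants_succ', List.map_flatMap]
          simp only [work, List.sum_map_add, List.flatMap, List.sum_flatten, List.map_map,
            Function.comp_def]
      _ ≤ (2 * nodeCost Q + 1) * q + q * (2 + m * (2 * nodeCost Q + 1)) := by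
          refine add_le_add ((List.sum_le_sum fun p _ => hnode p).trans ?_) (ih (by omega))
          rw [List.sum_map_mul_left]
          exact Nat.mul_le_mul_left _ (hnodes ⟨d, by omega⟩)
      _ = q * (2 + (m + 1) * (2 * nodeCost Q + 1)) := by ring

/-- A bound for the number of events of an execution, per answer in the worst case. -/
def searchCost (Q : JoinQuery) : ℕ := 2 + Q.numVars * (2 * nodeCost Q + 1)

theorem LeapfrogTriejoin.length_le {S : Set Q.Instance} (hS : ClosedUnderRenumbering S) {q : ℕ}
    (hq : ∀ A ∈ S, (answers A).encard ≤ q) {A : Q.Instance} (hA : A ∈ S) {tr : List (Event Q)}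
    (h : LeapfrogTriejoin A tr) : tr.length ≤ q * searchCost Q := by
  obtain ⟨tr', h', -, hlen⟩ := exists_leapfrogTriejoin A
  obtain rfl := h.unique h'
  have hnodes : ∀ d : Fin Q.numVars,
      ((descendants A d []).map fun p => max 1 (minChildren A p)).sum ≤ q := fun d => by
    exact_mod_cast (sum_max_one_minChildren_le_encard A d).trans (hq _ (hS A hA d))
  have hleaves : ((descendants A Q.numVars []).length : ℕ∞) ≤ q := by
    rw [← List.length_map (assignmentOf Q)]
    exact (length_le_encard_of_nodup (nodup_map_assignmentOf_descendants A)
      fun x hx => mem_map_assignmentOf_descendants.1 hx).trans (hq A hA)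
  refine hlen.trans ?_
  simpa [descendants, searchCost] using
    sum_work_le hnodes (by exact_mod_cast hleaves) (Nat.zero_add Q.numVars)

/-! ### Running time -/

lemma logb_two_natCast_mono : Monotone fun N : ℕ => Real.logb 2 N := by
  intro N M h
  rcases Nat.eq_zero_or_pos N with rfl | hN
  · simpa [Real.logb] using div_nonneg (Real.log_natCast_nonneg M) (Real.log_natCast_nonneg 2)
  · exact Real.logb_le_logb_of_le one_lt_two (by exact_mod_cast hN) (by exact_mod_cast h)

lemma logb_two_natCast_nonneg (N : ℕ) : 0 ≤ Real.logb 2 N := by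
  simpa using logb_two_natCast_mono (Nat.zero_le N)

namespace CostModel

variable {T : CostModel Q} {K : ℕ}

lemma Meets.apply_le (hT : T.Meets K) (A : Q.Instance) (h : List (Event Q)) (e : Event Q) :
    (T A h e : ℝ) ≤ K * (1 + Real.logb 2 (maxCard A)) := by
  obtain ⟨hram, hemit, hiter⟩ := hT A h
  have hK : (K : ℝ) ≤ K * (1 + Real.logb 2 (maxCard A)) :=
    le_mul_of_one_le_right (Nat.cast_nonneg K)
      (le_add_of_nonneg_right (logb_two_natCast_nonneg (maxCard A)))
  cases e with
  | iter j op =>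
    have hlog : Real.logb 2 (A j).card ≤ Real.logb 2 (maxCard A) :=
      logb_two_natCast_mono (Finset.le_sup (f := fun j => (A j).card) (Finset.mem_univ j))
    exact ((hiter j).2.2 op).trans (by gcongr)
  | ram => exact le_trans (by exact_mod_cast hram) hK
  | emit x => exact le_trans (by exact_mod_cast hemit x) hK

lemma Meets.time_le (hT : T.Meets K) (A : Q.Instance) (tr : List (Event Q)) :
    (T.time A tr : ℝ) ≤ tr.length * (K * (1 + Real.logb 2 (maxCard A))) := by
  rw [time, Nat.cast_sum]
  refine (Finset.sum_le_sum fun i _ => hT.apply_le A _ _).trans_eq ?_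
  rw [Finset.sum_const, Finset.card_univ, Fintype.card_fin, nsmul_eq_mul]

end CostModel

theorem LeapfrogTriejoin.time_le {S : Set Q.Instance} (hS : ClosedUnderRenumbering S) {q : ℕ}
    (hq : ∀ A ∈ S, (answers A).encard ≤ q) {A : Q.Instance} (hA : A ∈ S) {tr : List (Event Q)}
    (h : LeapfrogTriejoin A tr) {T : CostModel Q} {K : ℕ} (hT : T.Meets K) {M : ℕ}
    (hM : maxCard A ≤ M) :
    (T.time A tr : ℝ) ≤ searchCost Q * K * (q * (1 + Real.logb 2 M)) := by
  have hlen : (tr.length : ℝ) ≤ q * searchCost Q := by exact_mod_cast h.length_le hS hq hA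
  have hnonneg := logb_two_natCast_nonneg (maxCard A)
  have hlog : Real.logb 2 (maxCard A) ≤ Real.logb 2 M := logb_two_natCast_mono hM
  calc (T.time A tr : ℝ) ≤ tr.length * (K * (1 + Real.logb 2 (maxCard A))) := hT.time_le A tr
    _ ≤ q * searchCost Q * (K * (1 + Real.logb 2 M)) := by gcongr
    _ = searchCost Q * K * (q * (1 + Real.logb 2 M)) := by ring

theorem Algorithm.Computes.encard_answers_le_length {B : Algorithm Q} {S : Set Q.Instance}
    (hB : B.Computes S) {A : Q.Instance} (hA : A ∈ S) :
    (answers A).encard ≤ (B A).length := by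
  classical
  have hsub : answers A ⊆ ((B A).reduceOption.toFinset : Set Q.Assignment) := fun x hx => by
    simpa [List.reduceOption_mem_iff] using (hB A hA x).2 hx
  refine (Set.encard_le_encard hsub).trans ?_
  rw [Set.encard_coe_eq_coe_finsetCard]
  exact_mod_cast (List.toFinset_card_le _).trans (List.reduceOption_length_le _)

theorem exists_leapfrogTriejoin_output (A : Q.Instance) :
    ∃ tr, LeapfrogTriejoin A tr ∧ (output tr).Nodup ∧ ∀ x, x ∈ output tr ↔ x ∈ answers A := by
  obtain ⟨tr, h, hout, -⟩ := exists_leapfrogTriejoin A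
  exact ⟨tr, h, hout ▸ nodup_map_assignmentOf_descendants A,
    fun x => hout ▸ mem_map_assignmentOf_descendants⟩

end JoinQuery

open JoinQuery in
theorem mainTheorem3_general (Q : JoinQuery) :
    (∀ A : Q.Instance, ∃ tr, LeapfrogTriejoin A tr ∧ (output tr).Nodup ∧
      ∀ x, x ∈ output tr ↔ x ∈ answers A) ∧
    (∀ K : ℕ, ∃ C : ℝ, ∀ T : CostModel Q, T.Meets K →
      ∀ S : Set Q.Instance, ClosedUnderRenumbering S →
      ∀ q : ℕ, (∀ A ∈ S, (answers A).encard ≤ q) →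
        ∀ A ∈ S, ∀ tr, LeapfrogTriejoin A tr → ∀ M : ℕ, maxCard A ≤ M →
          (T.time A tr : ℝ) ≤ C * (q * (1 + Real.logb 2 M))) ∧
    (∀ (S : Set Q.Instance) (B : Algorithm Q), B.Computes S →
      ∀ A ∈ S, (answers A).encard ≤ (B A).length) :=
  ⟨exists_leapfrogTriejoin_output,
    fun K => ⟨searchCost Q * K, fun _ hT _ hS _ hq _ hA _ htr _ hM => htr.time_le hS hq hA hT hM⟩,
    fun _ _ hB _ hA => hB.encard_answers_le_length hA⟩

theorem mainTheorem3 (Q : JoinQuery) :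
    -- leapfrog triejoin terminates and outputs every tuple of the query result exactly once
    (∀ A : Q.Instance, ∃ tr, JoinQuery.LeapfrogTriejoin A tr ∧ (JoinQuery.output tr).Nodup ∧
      ∀ x, x ∈ JoinQuery.output tr ↔ x ∈ JoinQuery.answers A) ∧
    -- the constant `C` depends only on the query and the constant of the iterators
    (∀ K : ℕ, ∃ C : ℝ, ∀ T : JoinQuery.CostModel Q, T.Meets K →
      ∀ (P : Type*) [Preorder P] (F : JoinQuery.ProblemFamily Q P)
        (cons : Set (JoinQuery.ProjConstraint Q P)), F.IsDefinedBy cons →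
      ∀ (n : P) (q : ℕ),
        IsGreatest ((fun A => (JoinQuery.answers A).encard) '' F.inst n) (q : ℕ∞) → 0 < q →
        ∀ A ∈ F.inst n, ∀ tr, JoinQuery.LeapfrogTriejoin A tr →
          (T.time A tr : ℝ) ≤ C * (q * (1 + Real.logb 2 (JoinQuery.maxCard A))) ∧
          ∀ M : ℕ, IsGreatest (JoinQuery.maxCard '' F.inst n) M →
            (T.time A tr : ℝ) ≤ C * (q * (1 + Real.logb 2 M))) ∧
    -- every algorithm that computes the query needs at least `q(n)` steps in the worst case
    (∀ (P : Type*) [Preorder P] (F : JoinQuery.ProblemFamily Q P)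
        (cons : Set (JoinQuery.ProjConstraint Q P)), F.IsDefinedBy cons →
      ∀ (n : P) (q : ℕ),
        IsGreatest ((fun A => (JoinQuery.answers A).encard) '' F.inst n) (q : ℕ∞) →
        ∀ B : JoinQuery.Algorithm Q, B.Computes (F.inst n) →
          ∃ A ∈ F.inst n, q ≤ (B A).length) := by
  obtain ⟨hcorrect, hupper, hlower⟩ := mainTheorem3_general Q
  refine ⟨hcorrect, fun K => ?_, fun P _ F cons _ n q hq B hB => ?_⟩
  · obtain ⟨C, hC⟩ := hupper K
    refine ⟨C, fun T hT P _ F cons hF n q hq hpos A hA tr htr => ?_⟩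
    obtain ⟨⟨B, hB, hBq : (JoinQuery.answers B).encard = q⟩, hmax⟩ := hq
    have hne : (JoinQuery.answers B).Nonempty := by
      rw [← Set.encard_pos, hBq]
      exact_mod_cast hpos
    have htime := hC T hT _ (hF.closedUnderRenumbering hB hne) q
      (fun A' hA' => hmax ⟨A', hA', rfl⟩) A hA tr htr
    exact ⟨htime _ le_rfl, fun M hM => htime M (hM.2 ⟨A, hA, rfl⟩)⟩
  · obtain ⟨A, hA, hAq : (JoinQuery.answers A).encard = q⟩ := hq.1
    have hle := hlower _ B hB A hA
    rw [hAq] at hle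
    exact ⟨A, hA, by exact_mod_cast hle⟩
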